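/- Let $n\ge 4$ and let $\mathbf C_n=(\{0,\dots,n-1\};\wedge,\vee,\to,\bot,\top)$ be the $n$-element Heyting chain $0<1<\dots<n-1$, with $\bot=0$ and $\top=n-1$. Let $\mathcal G_n=\mathbb{ISP}(\mathbf C_n)$ be the class of Heyting algebras isomorphic to a subalgebra of a power of $\mathbf C_n$. For $1\le i\le n-3$ let $g_i$ be the partial endomorphism of $\mathbf C_n$ with domain $C_n\setminus\{i\}$ that sends $i+1$ to $i$ and fixes every other element of its domain, and let $f_i\colon C_n\setminus\{i+1\}\to C_n\setminus\{i\}$ be its inverse. For $1\le i\le n-2$ let $h_i$ be the endomorphism with $h_i(x)=x+1$ if $i\le x<n-1$ and $h_i(x)=x$ otherwise. Put $$\Sigma_n=\{f_1,g_1\}\times\dots\times\{f_{n-3},g_{n-3}\}\times\{h_1,\dots,h_{n-2}\}.$$ For $\sigma\in\Sigma_n$ let $\mathbf C_n^\sigma=(C_n;\sigma,\mathscr T)$, where $\mathscr T$ is the discrete topology, and let $\mathcal X^\sigma=\mathbb{IS}_c\mathbb P^+(\mathbf C_n^\sigma)$ be the class of topological structures isomorphic to a (possibly empty) closed substructure of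 a power of $\mathbf C_n^\sigma$. Here operations and partial operations are lifted pointwise to powers, a substructure is a subset closed under the (partial) operations wherever these are defined, and morphisms are the continuous maps preserving the (partial) operations. For $\mathbf A\in\mathcal G_n$ let $D(\mathbf A)$ be the set of homomorphisms $\mathbf A\to\mathbf C_n$, as a closed substructure of $(\mathbf C_n^\sigma)^A$. For $\mathbf X\in\mathcal X^\sigma$ let $E(\mathbf X)$ be the algebra, with pointwise operations, of all morphisms $\mathbf X\to\mathbf C_n^\sigma$. Say that $\mathbf C_n^\sigma$ *fully dualises* $\mathcal G_n$ if for every $\mathbf A\in\mathcal G_n$ the evaluation map $\mathbf A\to ED(\mathbf A)$, $a\mapsto(x\mapsto x(a))$, is an isomorphism, and $DE(\mathbf X)\cong\mathbf X$ for every $\mathbf X\in\mathcal X^\sigma$. **Theorem.** Let $n\ge4$ and $\sigma\in\Sigma_n$. Then $\mathbf C_n^\sigma$ fully dualises $\mathcal G_n$ if and only if $\sigma=(g_1,\dots,g_{n-3},h_1)$. Moreover, for every other $\sigma$ there is an explicit closed substructure of $\mathbf C_n^\sigma$ that is not isomorphic to $D(\mathbf A)$ for any $\mathbf A\in\mathcal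 G_n$: 1. if some $\sigma_i$ with $1\le i\le n-3$ equals $f_i$, and $j$ is the largest such $i$, then $\{j+1,\dots,n-1\}$ is such a substructure; 2. if $\sigma_i=g_i$ for all $1\le i\le n-3$ and $\sigma_{n-2}=h_k$ with $k\ne1$, then $\{1,n-1\}$ is such a substructure. -/

import Mathlib

universe u v w

namespace GodelDuality

section General

/-- A partial endomorphism of a Heyting algebra `M`: a partial map whose domain is a subalgebra
of `M` and which is a homomorphism from its domain to `M`.  (`y ∈ toPFun x` means that the map is
defined at `x` with value `y`.) -/
structure PartialEnd (M : Type w) [HeytingAlgebra M] where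
  toPFun : M →. M
  bot_mem : ⊥ ∈ toPFun ⊥
  top_mem : ⊤ ∈ toPFun ⊤
  inf_mem : ∀ {a b a' b' : M}, a' ∈ toPFun a → b' ∈ toPFun b → a' ⊓ b' ∈ toPFun (a ⊓ b)
  sup_mem : ∀ {a b a' b' : M}, a' ∈ toPFun a → b' ∈ toPFun b → a' ⊔ b' ∈ toPFun (a ⊔ b)
  himp_mem : ∀ {a b a' b' : M}, a' ∈ toPFun a → b' ∈ toPFun b → (a' ⇨ b') ∈ toPFun (a ⇨ b)

/-- A topological structure with an `I`-indexed family of partial unary operations (a total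
operation is one whose domain is everything).  The carrier may be empty. -/
structure TopStr (I : Type w) where
  carrier : Type u
  [top : TopologicalSpace carrier]
  op : I → carrier →. carrier

attribute [instance] TopStr.top

variable {I : Type w}

/-- Morphisms: continuous maps `φ` such that, whenever the `i`-th operation is defined at `x`, it is
defined at `φ x`, and `φ` carries the first value to the second. -/
structure TopStr.Hom (X : TopStr.{u} I) (Y : TopStr.{v} I) where
  toFun : X.carrier → Y.carrier
  continuous_toFun : Continuous toFun
  map_op : ∀ (i : I) (x x' : X.carrier), x' ∈ X.op i x → toFun x' ∈ Y.op i (toFun x)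

/-- Isomorphisms: homeomorphisms which preserve and reflect the graphs (hence also the domains) of
all the partial operations. -/
structure TopStr.Iso (X : TopStr.{u} I) (Y : TopStr.{v} I) where
  toHomeomorph : X.carrier ≃ₜ Y.carrier
  map_op_iff : ∀ (i : I) (x x' : X.carrier),
    toHomeomorph x' ∈ Y.op i (toHomeomorph x) ↔ x' ∈ X.op i x

/-- The power `Y ^ S`, with the product topology and pointwise lifted partial operations. -/
def TopStr.pow (Y : TopStr.{u} I) (S : Type v) : TopStr.{max u v} I where
  carrier := S → Y.carrier
  op i x := ⟨∀ s, (Y.op i (x s)).Dom, fun h s => (Y.op i (x s)).get (h s)⟩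

/-- `X` is closed under the partial operations of `Y` (wherever these are defined). -/
def TopStr.IsSub (Y : TopStr.{u} I) (X : Set Y.carrier) : Prop :=
  ∀ (i : I), ∀ x ∈ X, ∀ x' ∈ Y.op i x, x' ∈ X

/-- The substructure of `Y` on a set closed under the partial operations, with the subspace
topology; the domain of an operation on it is the intersection of its domain in `Y` with `X`. -/
def TopStr.sub (Y : TopStr.{u} I) (X : Set Y.carrier) (hX : Y.IsSub X) : TopStr.{u} I where
  carrier := X
  op i x := ⟨(Y.op i x.1).Dom,
    fun h => ⟨(Y.op i x.1).get h, hX i x.1 x.2 _ (Part.get_mem h)⟩⟩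

/-- `X ∈ IS_cP⁺(Y)`: `X` is isomorphic to a (possibly empty) closed substructure of a power of
`Y`. -/
def TopStr.InIScP (Y : TopStr.{v} I) (X : TopStr.{max u v} I) : Prop :=
  ∃ (S : Type u) (Z : Set (Y.pow S).carrier) (hZ : (Y.pow S).IsSub Z),
    IsClosed Z ∧ Nonempty (X.Iso ((Y.pow S).sub Z hZ))

/-- `A ∈ ISP(M)`: the Heyting algebra `A` embeds in a power of `M`. -/
def InISP (M : Type v) [HeytingAlgebra M] (A : Type u) [HeytingAlgebra A] : Prop :=
  ∃ (S : Type u) (f : HeytingHom A (S → M)), Function.Injective f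

variable {M : Type v} [HeytingAlgebra M]

/-- The alter ego `(M; R, discrete topology)` determined by a family `R` of partial
endomorphisms. -/
def alterEgo (R : I → PartialEnd M) : TopStr.{v} I where
  carrier := M
  top := ⊥
  op i := (R i).toPFun

instance (R : I → PartialEnd M) : DiscreteTopology (alterEgo R).carrier := ⟨rfl⟩

instance (R : I → PartialEnd M) : HeytingAlgebra (alterEgo R).carrier :=
  inferInstanceAs (HeytingAlgebra M)

variable (R : I → PartialEnd M)

/-- The set of homomorphisms `A → M`, as a subset of `M ^ A`. -/
def homSet (A : Type u) [HeytingAlgebra A] : Set ((alterEgo R).pow A).carrier :=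
  {x | ∃ f : HeytingHom A M, ∀ a, x a = f a}

theorem homSet_isSub (A : Type u) [HeytingAlgebra A] :
    ((alterEgo R).pow A).IsSub (homSet R A) := by
  rintro i x ⟨f, hf⟩ y hy
  have key : ∀ a, y a ∈ (R i).toPFun (f a) := by
    intro a
    obtain ⟨h, rfl⟩ := hy
    rw [← hf a]
    exact Part.get_mem (h a)
  refine ⟨{ toFun := y, map_sup' := ?_, map_inf' := ?_, map_bot' := ?_, map_himp' := ?_ },
    fun a => rfl⟩
  · intro a b
    have h := key (a ⊔ b)
    rw [map_sup] at h
    exact Part.mem_unique h ((R i).sup_mem (key a) (key b))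
  · intro a b
    have h := key (a ⊓ b)
    rw [map_inf] at h
    exact Part.mem_unique h ((R i).inf_mem (key a) (key b))
  · have h := key ⊥
    rw [map_bot] at h
    exact Part.mem_unique h (R i).bot_mem
  · intro a b
    have h := key (a ⇨ b)
    rw [map_himp] at h
    exact Part.mem_unique h ((R i).himp_mem (key a) (key b))

/-- The dual `D(A)` of a Heyting algebra `A`: the set of homomorphisms `A → M`, as a substructure
of the power `(alterEgo R) ^ A`. -/
def D (A : Type u) [HeytingAlgebra A] : TopStr.{max v u} I :=
  ((alterEgo R).pow A).sub (homSet R A) (homSet_isSub R A)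

/-- The dual `E(X)` of a structure `X`: the morphisms from `X` to the alter ego. -/
abbrev E (X : TopStr.{u} I) : Type (max u v) := X.Hom (alterEgo R)

namespace E

variable {R} {X : TopStr.{u} I}

/-- A morphism viewed as an element of the algebra `M ^ X`. -/
def val (f : E R X) : X.carrier → M := f.toFun

theorem val_injective : Function.Injective (val : E R X → X.carrier → M) := by
  rintro ⟨f, _, _⟩ ⟨g, _, _⟩ h
  cases h
  rfl

private theorem cont₂ (F : M → M → M) (f g : E R X) :
    Continuous (Y := (alterEgo R).carrier) fun x => F (f.toFun x) (g.toFun x) :=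
  Continuous.comp (Y := (alterEgo R).carrier × (alterEgo R).carrier) (Z := (alterEgo R).carrier)
    (g := fun p => F p.1 p.2) continuous_of_discreteTopology
    (f.continuous_toFun.prodMk g.continuous_toFun)

instance : Bot (E R X) := ⟨⟨fun _ => (⊥ : M), continuous_const (Y := (alterEgo R).carrier), fun i _ _ _ => (R i).bot_mem⟩⟩

instance : Top (E R X) := ⟨⟨fun _ => (⊤ : M), continuous_const (Y := (alterEgo R).carrier), fun i _ _ _ => (R i).top_mem⟩⟩

instance : Min (E R X) := ⟨fun f g => ⟨fun x => (f.toFun x ⊓ g.toFun x : M),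
  cont₂ (fun a b => a ⊓ b) f g,
  fun i x x' h => (R i).inf_mem (f.map_op i x x' h) (g.map_op i x x' h)⟩⟩

instance : Max (E R X) := ⟨fun f g => ⟨fun x => (f.toFun x ⊔ g.toFun x : M),
  cont₂ (fun a b => a ⊔ b) f g,
  fun i x x' h => (R i).sup_mem (f.map_op i x x' h) (g.map_op i x x' h)⟩⟩

instance : HImp (E R X) := ⟨fun f g => ⟨fun x => (f.toFun x ⇨ g.toFun x : M),
  cont₂ (fun a b => a ⇨ b) f g,
  fun i x x' h => (R i).himp_mem (f.map_op i x x' h) (g.map_op i x x' h)⟩⟩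

instance : Compl (E R X) := ⟨fun f => f ⇨ ⊥⟩

instance : LE (E R X) := ⟨fun f g => f.val ≤ g.val⟩

instance : LT (E R X) := ⟨fun f g => f.val < g.val⟩

/-- `E(X)` with the operations inherited pointwise from `M`. -/
instance : HeytingAlgebra (E R X) :=
  Function.Injective.heytingAlgebra (val : E R X → X.carrier → M) val_injective
    Iff.rfl Iff.rfl (fun _ _ => rfl) (fun _ _ => rfl) rfl rfl
    (fun f => himp_bot (f.val)) (fun _ _ => rfl)

end E

/-- The evaluation homomorphism `e_A : A → E(D(A))`, `e_A(a)(x) = x(a)`. -/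
def evalHom (A : Type u) [HeytingAlgebra A] : HeytingHom A (E R (D R A)) where
  toFun a :=
    { toFun := fun x => x.1 a
      continuous_toFun := (continuous_apply a).comp continuous_subtype_val
      map_op := by
        rintro i x x' ⟨h, rfl⟩
        exact Part.get_mem (h a) }
  map_sup' a b := E.val_injective <| funext fun x => by
    obtain ⟨f, hf⟩ := x.2
    change x.1 (a ⊔ b) = (x.1 a ⊔ x.1 b : M)
    rw [hf, hf, hf]
    exact map_sup (β := M) f a b
  map_inf' a b := E.val_injective <| funext fun x => by
    obtain ⟨f, hf⟩ := x.2
    change x.1 (a ⊓ b) = (x.1 a ⊓ x.1 b : M)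
    rw [hf, hf, hf]
    exact map_inf (β := M) f a b
  map_bot' := E.val_injective <| funext fun x => by
    obtain ⟨f, hf⟩ := x.2
    change x.1 ⊥ = (⊥ : M)
    rw [hf]
    exact map_bot f
  map_himp' a b := E.val_injective <| funext fun x => by
    obtain ⟨f, hf⟩ := x.2
    change x.1 (a ⇨ b) = (x.1 a ⇨ x.1 b : M)
    rw [hf, hf, hf]
    exact map_himp (β := M) f a b

/-- The alter ego given by `R` yields a duality on `ISP(M)`: for every `A ∈ ISP(M)` the evaluation
homomorphism `A → E(D(A))` is an isomorphism. -/
def Dualises : Prop :=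
  ∀ (A : Type u) [HeytingAlgebra A], InISP M A → Function.Bijective (evalHom R A)

/-- The alter ego given by `R` fully dualises `ISP(M)`: it yields a duality, and every structure
`X ∈ IS_cP⁺(alterEgo R)` is isomorphic to `D(E(X))`. -/
def FullyDualises : Prop :=
  Dualises.{max u v} R ∧
    ∀ X : TopStr.{max u v} I, TopStr.InIScP.{u} (alterEgo R) X → Nonempty ((D R (E R X)).Iso X)

/-- `X ⊆ M` is the universe of a closed substructure of the alter ego given by `R` which is not
isomorphic to the dual `D(A)` of any algebra `A ∈ ISP(M)`. -/
def IsClosedNonDual (X : Set M) : Prop :=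
  IsClosed (X := (alterEgo R).carrier) X ∧ ∃ hX : (alterEgo R).IsSub X,
    ∀ (A : Type u) [HeytingAlgebra A], InISP M A →
      IsEmpty (((alterEgo R).sub X hX).Iso (D R A))

end General

section Chain

/-- The `n`-element Heyting chain `0 < 1 < ⋯ < n - 1`. -/
abbrev C (n : ℕ) : Type := Fin n

variable (n : ℕ) [NeZero n]

theorem C_himp (a b : C n) : (a ⇨ b) = if a ≤ b then ⊤ else b := rfl

variable {n} in
/-- A partial map on the chain fixing `⊥` and `⊤`, monotone, and strictly monotone except possibly
where the larger value is `⊤`, is a partial endomorphism. -/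
def PartialEnd.ofChain (φ : C n →. C n) (hbot : ⊥ ∈ φ ⊥) (htop : ⊤ ∈ φ ⊤)
    (hlt : ∀ {a b a' b' : C n}, a' ∈ φ a → b' ∈ φ b → a < b → a' < b' ∨ (a' = ⊤ ∧ b' = ⊤)) :
    PartialEnd (C n) :=
  have hle : ∀ {a b a' b' : C n}, a' ∈ φ a → b' ∈ φ b → a ≤ b → a' ≤ b' := by
    intro a b a' b' ha hb h
    rcases h.lt_or_eq with h | rfl
    · rcases hlt ha hb h with h | ⟨rfl, rfl⟩
      · exact h.le
      · exact le_rfl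
    · exact (Part.mem_unique ha hb).le
  { toPFun := φ
    bot_mem := hbot
    top_mem := htop
    inf_mem := by
      intro a b a' b' ha hb
      rcases le_total a b with h | h
      · rwa [inf_eq_left.2 h, inf_eq_left.2 (hle ha hb h)]
      · rwa [inf_eq_right.2 h, inf_eq_right.2 (hle hb ha h)]
    sup_mem := by
      intro a b a' b' ha hb
      rcases le_total a b with h | h
      · rwa [sup_eq_right.2 h, sup_eq_right.2 (hle ha hb h)]
      · rwa [sup_eq_left.2 h, sup_eq_left.2 (hle hb ha h)]
    himp_mem := by
      intro a b a' b' ha hb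
      rcases le_or_gt a b with h | h
      · rwa [himp_eq_top_iff.2 h, himp_eq_top_iff.2 (hle ha hb h)]
      · rw [C_himp, C_himp, if_neg h.not_ge]
        rcases hlt hb ha h with h' | ⟨rfl, rfl⟩
        · rwa [if_neg h'.not_ge]
        · simpa using hb }

/-- For `1 ≤ i ≤ n - 3`, the partial endomorphism `g_i` with domain `C_n \ {i}`, which sends `i + 1`
to `i` and fixes all other elements of its domain. -/
def gMap (i : Set.Icc 1 (n - 3)) : PartialEnd (C n) :=
  PartialEnd.ofChain
    (fun x => ⟨x.val ≠ i.1,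
      fun _ => if x.val = i.1 + 1 then ⟨i.1, by have := i.2.1; have := i.2.2; omega⟩ else x⟩)
    (by
      obtain ⟨i, h1, h2⟩ := i
      refine ⟨?_, ?_⟩
      · change (0 : ℕ) ≠ i; omega
      · exact if_neg (t := (⟨i, by omega⟩ : C n)) (show ¬ (0 : ℕ) = i + 1 by omega))
    (by
      obtain ⟨i, h1, h2⟩ := i
      refine ⟨?_, ?_⟩
      · change n - 1 ≠ i; omega
      · exact if_neg (show ¬ n - 1 = i + 1 by omega))
    (by
      obtain ⟨i, h1, h2⟩ := i
      rintro a b a' b' ⟨ha, rfl⟩ ⟨hb, rfl⟩ h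
      left
      change a.val ≠ i at ha
      change b.val ≠ i at hb
      change (if a.val = i + 1 then _ else _) < (if b.val = i + 1 then _ else _)
      have h' : a.val < b.val := h
      split_ifs <;> rw [Fin.lt_def] <;> (try dsimp only) <;> omega)

/-- For `1 ≤ i ≤ n - 3`, the inverse `f_i` of `g_i`: its domain is `C_n \ {i + 1}`, it sends `i` to
`i + 1` and fixes all other elements of its domain. -/
def fMap (i : Set.Icc 1 (n - 3)) : PartialEnd (C n) :=
  PartialEnd.ofChain
    (fun x => ⟨x.val ≠ i.1 + 1,
      fun _ => if x.val = i.1 then ⟨i.1 + 1, by have := i.2.1; have := i.2.2; omega⟩ else x⟩)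
    (by
      obtain ⟨i, h1, h2⟩ := i
      refine ⟨?_, ?_⟩
      · change (0 : ℕ) ≠ i + 1; omega
      · exact if_neg (show ¬ (0 : ℕ) = i by omega))
    (by
      obtain ⟨i, h1, h2⟩ := i
      refine ⟨?_, ?_⟩
      · change n - 1 ≠ i + 1; omega
      · exact if_neg (show ¬ n - 1 = i by omega))
    (by
      obtain ⟨i, h1, h2⟩ := i
      rintro a b a' b' ⟨ha, rfl⟩ ⟨hb, rfl⟩ h
      left
      change a.val ≠ i + 1 at ha
      change b.val ≠ i + 1 at hb
      change (if a.val = i then _ else _) < (if b.val = i then _ else _)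
      have h' : a.val < b.val := h
      split_ifs <;> rw [Fin.lt_def] <;> (try dsimp only) <;> omega)

/-- For `1 ≤ i ≤ n - 2`, the endomorphism `h_i` with range `C_n \ {i}`: `h_i(x) = x + 1` if
`i ≤ x < n - 1` and `h_i(x) = x` otherwise. -/
def hMap (i : Set.Icc 1 (n - 2)) : PartialEnd (C n) :=
  PartialEnd.ofChain
    (fun x => Part.some
      (if hx : i.1 ≤ x.val ∧ x.val < n - 1 then ⟨x.val + 1, by omega⟩ else x))
    (by
      obtain ⟨i, h1, h2⟩ := i
      rw [Part.mem_some_iff, dif_neg]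
      rintro ⟨h, -⟩
      change i ≤ 0 at h
      omega)
    (by
      rw [Part.mem_some_iff, dif_neg]
      rintro ⟨-, h⟩
      change n - 1 < n - 1 at h
      omega)
    (by
      obtain ⟨i, h1, h2⟩ := i
      intro a b a' b' ha hb h
      rw [Part.mem_some_iff] at ha hb
      subst ha hb
      have h' : a.val < b.val := h
      have := b.2
      split_ifs <;> simp only [Fin.lt_def, Fin.ext_iff, Fin.val_top] <;> omega)

/-- `f_i` and `g_i` are mutually inverse partial maps. -/
theorem mem_fMap_iff (i : Set.Icc 1 (n - 3)) (x y : C n) :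
    y ∈ (fMap n i).toPFun x ↔ x ∈ (gMap n i).toPFun y := by
  obtain ⟨i, h1, h2⟩ := i
  change (∃ _ : x.val ≠ i + 1, (if x.val = i then _ else _) = y) ↔
    (∃ _ : y.val ≠ i, (if y.val = i + 1 then _ else _) = x)
  split_ifs <;> simp only [Fin.ext_iff] <;> grind

/-- The index set of the tuples in `Σ_n`: the indices `1, …, n - 3` of the partial endomorphisms,
and one more index for the endomorphism. -/
abbrev Idx : Type := Set.Icc 1 (n - 3) ⊕ Unit

/-- `Σ_n = {f_1, g_1} × ⋯ × {f_{n-3}, g_{n-3}} × {h_1, …, h_{n-2}}`. -/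
def SigmaTuples : Set (Idx n → PartialEnd (C n)) :=
  {σ | (∀ i, σ (Sum.inl i) = fMap n i ∨ σ (Sum.inl i) = gMap n i) ∧ ∃ k, σ (Sum.inr ()) = hMap n k}

/-- The tuple `(g_1, …, g_{n-3}, h_1)`, for `n ≥ 4`. -/
def gh₁ (hn : 4 ≤ n) : Idx n → PartialEnd (C n) :=
  Sum.elim (gMap n) (fun _ => hMap n ⟨1, le_rfl, by omega⟩)

end Chain

end GodelDuality

/-! Everything rests on one fact about the chain: each homomorphism from a subalgebra of `C n` into
`C n` arises from the inclusion by finitely many applications of the `g_i` and `h_1`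
(`IsHomOn.induction`). So for the tuple `gh₁`, substructures of powers are closed under all these
homomorphisms (`isHomOn_mem`), and morphisms out of duals commute with them (`toFun_isHomOn`).

A homomorphism into the chain is controlled by the filter it sends to `⊤`: if that of `f` lies in
that of `g`, then `g` is `f` followed by such a map (`exists_isHomOn_factor`). For duality this
allows a morphism on `D(A)` to be interpolated at any two points; compactness then represents it by
a single element of `A`. For fullness, compactness places the filter of some evaluation inside that
of a given homomorphism on `E(X)`, which is therefore obtained from an evaluation, and so is itself
one.

For the other tuples, count. A point of `D(A)` where an operation is undefined takes a value other
than `⊥` and `⊤`, which forces `D(A)` to have at least `n - 1` points. The exhibited sets contain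
such a point but are smaller. -/

namespace GodelDuality

/-! ### Homomorphisms between subalgebras of the chain and their generation -/

section Maps

variable {n : ℕ} [NeZero n]

theorem mem_gMap (i : Set.Icc 1 (n - 3)) (x y : C n) :
    y ∈ (gMap n i).toPFun x ↔ x.val ≠ i.1 ∧ y.val = if x.val = i.1 + 1 then i.1 else x.val := by
  change (∃ _ : x.val ≠ i.1, (if x.val = i.1 + 1 then _ else _) = y) ↔ _
  split_ifs <;> simp only [Fin.ext_iff] <;> grind

theorem mem_hMap (i : Set.Icc 1 (n - 2)) (x y : C n) :
    y ∈ (hMap n i).toPFun x ↔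
      y.val = if i.1 ≤ x.val ∧ x.val < n - 1 then x.val + 1 else x.val := by
  change y ∈ Part.some (if hx : i.1 ≤ x.val ∧ x.val < n - 1 then _ else _) ↔ _
  rw [Part.mem_some_iff, Fin.ext_iff]
  split_ifs <;> simp

theorem C_eq_bot_iff (x : C n) : x = ⊥ ↔ x.val = 0 := by
  rw [Fin.ext_iff]; rfl

theorem C_eq_top_iff (x : C n) : x = ⊤ ↔ x.val = n - 1 := by
  rw [Fin.ext_iff, Fin.val_top]

end Maps

/-- The map `e` restricts to a homomorphism on the subalgebra `R` of the chain. -/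
structure IsHomOn {n : ℕ} [NeZero n] (R : Set (C n)) (e : C n → C n) : Prop where
  bot : e ⊥ = ⊥
  top : e ⊤ = ⊤
  lt : ∀ a ∈ R, ∀ b ∈ R, a < b → e a < e b ∨ (e a = ⊤ ∧ e b = ⊤)

namespace IsHomOn

variable {n : ℕ} [NeZero n]

theorem le {R : Set (C n)} {e : C n → C n} (h : IsHomOn R e) {a b : C n} (ha : a ∈ R)
    (hb : b ∈ R) (hab : a ≤ b) : e a ≤ e b := by
  rcases hab.lt_or_eq with hab | rfl
  · rcases h.lt a ha b hb hab with h | ⟨h, h'⟩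
    · exact h.le
    · rw [h, h']
  · exact le_rfl

theorem mono {R S : Set (C n)} {e : C n → C n} (h : IsHomOn S e) (hRS : R ⊆ S) : IsHomOn R e :=
  ⟨h.bot, h.top, fun a ha b hb => h.lt a (hRS ha) b (hRS hb)⟩

/-- Homomorphisms with the same kernel can be moved down by the operations `g_i`. -/
theorem induction_of_le (hn : 4 ≤ n) {R : Finset (C n)} {P : (C n → C n) → Prop}
    (hP : ∀ i e e', P e → (∀ r ∈ R, e' r ∈ (gh₁ n hn i).toPFun (e r)) → P e')
    (hcongr : ∀ e e', P e → (∀ r ∈ R, e' r = e r) → P e')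
    {e' : C n → C n} (he' : IsHomOn (R : Set (C n)) e') (hbot : ⊥ ∈ R)
    (e : C n → C n) (he : IsHomOn (R : Set (C n)) e) (hle : ∀ r ∈ R, e' r ≤ e r)
    (htop : ∀ r ∈ R, e r = ⊤ → e' r = ⊤) (h : P e) : P e' := by
  -- Each step lowers one value of `e` on `R` by one, so this sum decreases.
  induction hN : ∑ r ∈ R, (e r).val using Nat.strong_induction_on generalizing e with
  | _ N ih =>
  by_cases hne : ∃ r, r ∈ R ∧ e' r < e r
  swap
  · push Not at hne
    exact hcongr e e' h fun r hr => le_antisymm (hle r hr) (hne r hr)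
  -- At the least disagreement the value just below `e r` is free: smaller points have values under
  -- `e' r < e r`, larger ones have values above `e r`. Hence `g_m` with `m + 1 = e r` is defined
  -- along `e` and moves only the value at `r`.
  obtain ⟨r, ⟨hr, hlt⟩, hmin⟩ : ∃ r, (r ∈ R ∧ e' r < e r) ∧ ∀ s ∈ R, s < r → e' s = e s := by
    obtain ⟨r, hr⟩ := exists_minimal_of_wellFoundedLT (fun r => r ∈ R ∧ e' r < e r) hne
    refine ⟨r, hr.prop, fun s hs hsr => ?_⟩
    by_contra hne'
    exact (hr.le_of_le ⟨hs, lt_of_le_of_ne (hle s hs) hne'⟩ hsr.le).not_gt hsr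
  have hr0 : r ≠ ⊥ := by
    rintro rfl
    rw [he.bot, he'.bot] at hlt
    exact lt_irrefl _ hlt
  have hr1 : e r ≠ ⊤ := fun h1 => by
    rw [htop r hr h1, h1] at hlt
    exact lt_irrefl _ hlt
  have hr1' : r ≠ ⊤ := by
    rintro rfl
    exact hr1 he.top
  have he'r : e' r ≠ ⊤ := hlt.ne_top
  have hpos : 0 < (e' r).val := by
    rcases he'.lt ⊥ hbot r hr (bot_lt_iff_ne_bot.2 hr0) with h | ⟨-, h⟩
    · exact (Nat.zero_le _).trans_lt h
    · exact absurd h he'r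
  have hlt' : (e' r).val < (e r).val := hlt
  have hlt1 : (e r).val < n - 1 := by
    have := (e r).2
    have := mt (C_eq_top_iff (e r)).2 hr1
    omega
  obtain ⟨m, hm⟩ : ∃ m, (e r).val = m + 1 := ⟨(e r).val - 1, by omega⟩
  have hsmall : ∀ s ∈ R, s < r → (e s).val < (e' r).val := by
    intro s hs hsr
    rw [← hmin s hs hsr]
    rcases he'.lt s hs r hr hsr with h | ⟨-, h⟩
    · exact h
    · exact absurd h he'r
  have hlarge : ∀ s ∈ R, r < s → m + 1 < (e s).val := by
    intro s hs hsr
    rw [← hm]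
    rcases he.lt r hr s hs hsr with h | ⟨h, -⟩
    · exact h
    · exact absurd h hr1
  let e₁ : C n → C n := Function.update e r ⟨m, by omega⟩
  have e₁r : e₁ r = ⟨m, by omega⟩ := Function.update_self ..
  have e₁s : ∀ s, s ≠ r → e₁ s = e s := fun s hs => Function.update_of_ne hs ..
  refine ih _ ?_ e₁ ⟨?_, ?_, ?_⟩ ?_ ?_ ?_ rfl
  · rw [← hN]
    refine Finset.sum_lt_sum (fun s _ => ?_) ⟨r, hr, ?_⟩
    · rcases eq_or_ne s r with rfl | hs
      · rw [e₁r]; dsimp only; omega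
      · rw [e₁s s hs]
    · rw [e₁r]; dsimp only; omega
  · rw [e₁s _ hr0.symm, he.bot]
  · rw [e₁s _ hr1'.symm, he.top]
  · intro a ha b hb hab
    rcases eq_or_ne a r with rfl | ha'
    · have := hlarge b hb hab
      rw [e₁r, e₁s b hab.ne']
      left
      rw [Fin.lt_def]; dsimp only; omega
    rcases eq_or_ne b r with rfl | hb'
    · have := hsmall a ha hab
      rw [e₁r, e₁s a hab.ne]
      left
      rw [Fin.lt_def]; dsimp only; omega
    rw [e₁s a ha', e₁s b hb']
    exact he.lt a ha b hb hab
  · intro s hs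
    rcases eq_or_ne s r with rfl | hs'
    · rw [e₁r, Fin.le_def]; dsimp only; omega
    · rw [e₁s s hs']; exact hle s hs
  · intro s hs
    rcases eq_or_ne s r with rfl | hs'
    · rw [e₁r, C_eq_top_iff]; dsimp only; omega
    · rw [e₁s s hs']; exact htop s hs
  · refine hP (Sum.inl ⟨m, by omega, by omega⟩) e e₁ h fun s hs => ?_
    refine (mem_gMap _ _ _).2 ?_
    dsimp only
    rcases lt_trichotomy s r with hs' | rfl | hs'
    · have := hsmall s hs hs'
      rw [e₁s s hs'.ne, if_neg (by omega)]
      exact ⟨by omega, rfl⟩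
    · rw [e₁r, if_pos hm]
      exact ⟨by omega, rfl⟩
    · have := hlarge s hs hs'
      rw [e₁s s hs'.ne', if_neg (by omega)]
      exact ⟨by omega, rfl⟩

/-- Every homomorphism from a subalgebra `R` of the chain is obtained from the inclusion by
successive application of the operations `g_i` and `h_1`. -/
theorem induction (hn : 4 ≤ n) {R : Finset (C n)} {P : (C n → C n) → Prop}
    (hP : ∀ i e e', P e → (∀ r ∈ R, e' r ∈ (gh₁ n hn i).toPFun (e r)) → P e')
    (hcongr : ∀ e e', P e → (∀ r ∈ R, e' r = e r) → P e')
    (hid : P id) (hbot : ⊥ ∈ R) {e : C n → C n}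
    (he : IsHomOn (R : Set (C n)) e) : P e := by
  have hbt : (⊥ : C n) ≠ ⊤ := by
    rw [Ne, C_eq_top_iff]; change ¬ 0 = n - 1; omega
  -- The rank of `r` in `R`: apart from `⊤`, it gives the lowest embedding of `R`.
  let c : C n → ℕ := fun r => (R.filter (· < r)).card
  have c_mono : ∀ r s, r ≤ s → c r ≤ c s := fun r s hrs =>
    Finset.card_le_card fun t ht => by
      rw [Finset.mem_filter] at ht ⊢
      exact ⟨ht.1, ht.2.trans_le hrs⟩
  have c_lt : ∀ r ∈ R, ∀ s, r < s → c r < c s := fun r hr s hrs => by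
    refine Finset.card_lt_card ⟨fun t ht => ?_, fun hsub => ?_⟩
    · rw [Finset.mem_filter] at ht ⊢
      exact ⟨ht.1, ht.2.trans hrs⟩
    · have := hsub (Finset.mem_filter.2 ⟨hr, hrs⟩)
      rw [Finset.mem_filter] at this
      exact lt_irrefl _ this.2
  have c_le : ∀ r : C n, c r ≤ r.val := fun r => by
    rw [← Fin.card_Iio r]
    refine Finset.card_le_card fun t ht => ?_
    rw [Finset.mem_filter] at ht
    exact Finset.mem_Iio.2 ht.2
  have c_bot : c ⊥ = 0 := Nat.le_zero.1 (c_le ⊥)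
  have c_pos : ∀ r, r ≠ ⊥ → 0 < c r := fun r hr =>
    (Nat.zero_le _).trans_lt (c_lt ⊥ hbot r (bot_lt_iff_ne_bot.2 hr))
  -- The lowest embedding shifted up `k` times by `h_1`, with overflow absorbed by `⊤`. The value at
  -- `⊥` is set apart because `h_1` fixes `0`.
  let E : ℕ → C n → C n := fun k r =>
    if r = ⊤ then ⊤ else if r = ⊥ then ⊥ else ⟨min (c r + k) (n - 1), by omega⟩
  have E_bot : ∀ k, E k ⊥ = ⊥ := fun k => by simp [E, hbt]
  have E_top : ∀ k, E k ⊤ = ⊤ := fun k => by simp [E]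
  have E_val : ∀ k r, r ≠ ⊥ → r ≠ ⊤ → (E k r).val = min (c r + k) (n - 1) := fun k r h0 h1 => by
    simp [E, h0, h1]
  have E_hom : ∀ k, IsHomOn (R : Set (C n)) (E k) := fun k => by
    refine ⟨E_bot k, E_top k, fun a ha b hb hab => ?_⟩
    rcases eq_or_ne a ⊥ with rfl | ha0
    · left
      rw [E_bot]
      rcases eq_or_ne b ⊤ with rfl | hb1
      · rw [E_top]; exact hab
      · have := c_pos b hab.ne'
        rw [Fin.lt_def, E_val k b hab.ne' hb1]
        change 0 < _
        omega
    have ha1 : a ≠ ⊤ := hab.ne_top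
    have hb0 : b ≠ ⊥ := ((bot_lt_iff_ne_bot.2 ha0).trans hab).ne'
    rw [Fin.lt_def, C_eq_top_iff, C_eq_top_iff, E_val k a ha0 ha1]
    rcases eq_or_ne b ⊤ with rfl | hb1
    · rw [E_top, Fin.val_top]
      omega
    · have := c_lt a ha b hab
      rw [E_val k b hb0 hb1]
      omega
  have hE : ∀ k, P (E k) := fun k => by
    induction k with
    | zero =>
      refine induction_of_le hn hP hcongr (E_hom 0) hbot id ⟨rfl, rfl, fun _ _ _ _ h => .inl h⟩
        (fun r _ => ?_) (fun r _ h => ?_) hid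
      · rcases eq_or_ne r ⊥ with rfl | h0
        · rw [E_bot]; exact le_rfl
        rcases eq_or_ne r ⊤ with rfl | h1
        · rw [E_top]; exact le_rfl
        have := c_le r
        rw [Fin.le_def, E_val 0 r h0 h1, id]
        omega
      · rw [id] at h
        rw [h, E_top]
    | succ k ih =>
      refine hP (Sum.inr ()) _ _ ih fun r _ => (mem_hMap _ _ _).2 ?_
      dsimp only
      rcases eq_or_ne r ⊥ with rfl | h0
      · rw [E_bot, E_bot, if_neg]
        change ¬ (1 ≤ 0 ∧ _)
        omega
      rcases eq_or_ne r ⊤ with rfl | h1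
      · rw [E_top, E_top, if_neg]
        rw [Fin.val_top]
        omega
      have := c_pos r h0
      rw [E_val _ r h0 h1, E_val _ r h0 h1]
      split_ifs <;> omega
  -- The elements of `R` above `m` are exactly those that `e` collapses to `⊤`.
  obtain ⟨m, hm⟩ := exists_maximal_of_wellFoundedGT (fun r => r ∈ R ∧ e r ≠ ⊤)
    ⟨⊥, hbot, by rwa [he.bot]⟩
  have hm1 : m ≠ ⊤ := by
    rintro rfl
    exact hm.prop.2 he.top
  have hmax : ∀ r ∈ R, e r ≠ ⊤ → r ≤ m := fun r hr hr1 => by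
    by_contra hlt
    exact hlt (hm.le_of_ge ⟨hr, hr1⟩ (not_le.1 hlt).le)
  have hem : (e m).val < n - 1 := by
    have := (e m).2
    have := mt (C_eq_top_iff (e m)).2 hm.prop.2
    omega
  -- Up to `m` the map `e` is strictly increasing, so the points of `R` in `[r, m)` inject into `[e
  -- r, e m)`.
  have hgap : ∀ r ∈ R, e r ≠ ⊤ → (e r).val + c m ≤ (e m).val + c r := by
    intro r hr hr1
    have hrm := hmax r hr hr1
    have h1 : R.filter (· < m) = R.filter (· < r) ∪ R.filter (fun t => r ≤ t ∧ t < m) := by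
      ext t
      simp only [Finset.mem_union, Finset.mem_filter]
      constructor
      · rintro ⟨ht, htm⟩
        rcases lt_or_ge t r with h | h
        · exact .inl ⟨ht, h⟩
        · exact .inr ⟨ht, h, htm⟩
      · rintro (⟨ht, h⟩ | ⟨ht, -, h⟩)
        · exact ⟨ht, h.trans_le hrm⟩
        · exact ⟨ht, h⟩
    have h2 : (R.filter (fun t => r ≤ t ∧ t < m)).card ≤ (Finset.Ico (e r) (e m)).card := by
      refine Finset.card_le_card_of_injOn e ?_ ?_
      · intro t ht
        simp only [Finset.coe_filter, Set.mem_ofPred_eq] at ht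
        refine Finset.mem_coe.2 (Finset.mem_Ico.2 ⟨he.le hr ht.1 ht.2.1, ?_⟩)
        rcases he.lt t ht.1 m hm.prop.1 ht.2.2 with h | ⟨-, h⟩
        · exact h
        · exact absurd h hm.prop.2
      · intro s hs t ht hst
        simp only [Finset.coe_filter, Set.mem_ofPred_eq] at hs ht
        have key : ∀ u ∈ R, ∀ v ∈ R, v < m → u < v → e u ≠ e v := by
          intro u hu v hv hvm huv heq
          rcases he.lt u hu v hv huv with h | ⟨-, h⟩
          · exact h.ne heq
          · rcases he.lt v hv m hm.prop.1 hvm with h' | ⟨-, h'⟩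
            · exact h'.ne_top h
            · exact hm.prop.2 h'
        rcases lt_trichotomy s t with h | h | h
        · exact absurd hst (key s hs.1 t ht.1 ht.2.2 h)
        · exact h
        · exact absurd hst.symm (key t ht.1 s hs.1 hs.2.2 h)
    have h3 : c m ≤ c r + (R.filter (fun t => r ≤ t ∧ t < m)).card := by
      change (R.filter (· < m)).card ≤ _
      rw [h1]
      exact Finset.card_union_le _ _
    have h4 : (e r).val ≤ (e m).val := he.le hr hm.prop.1 hrm
    rw [Fin.card_Ico] at h2
    omega
  have hcm : c m ≤ n - 2 := by
    have := c_le m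
    have := m.2
    have := mt (C_eq_top_iff m).2 hm1
    omega
  -- This shift sends `m`, unless it is `⊥`, to `n - 2`, just under `⊤`. So `E` collapses the same
  -- elements as `e` and dominates it by `hgap`; the `g_i` then bring it down to `e`.
  refine induction_of_le hn hP hcongr he hbot (E (n - 2 - c m)) (E_hom _) (fun r hr => ?_)
    (fun r hr => ?_) (hE _)
  · rcases eq_or_ne r ⊥ with rfl | h0
    · rw [E_bot, he.bot]
    rcases eq_or_ne r ⊤ with rfl | h1
    · rw [E_top]; exact le_top
    rw [Fin.le_def, E_val _ r h0 h1]
    by_cases hr1 : e r = ⊤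
    · have hmr : c m < c r := c_lt m hm.prop.1 r <| by
        by_contra hle
        have := he.le hr hm.prop.1 (not_lt.1 hle)
        rw [hr1, top_le_iff] at this
        exact hm.prop.2 this
      have := (e r).2
      omega
    · have := hgap r hr hr1
      omega
  · contrapose
    intro hr1
    rcases eq_or_ne r ⊥ with rfl | h0
    · rwa [E_bot]
    have h1 : r ≠ ⊤ := by
      rintro rfl
      exact hr1 he.top
    have := c_mono r m (hmax r hr hr1)
    rw [C_eq_top_iff, E_val _ r h0 h1]
    omega

end IsHomOn

end GodelDuality

namespace GodelDuality

/-! ### Factorisation of homomorphisms, and closure of substructures of powers -/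

section Homs

variable {n : ℕ} [NeZero n] {A : Type*} [HeytingAlgebra A]

/-- The composite of a homomorphism into the chain with a homomorphism defined on its range. -/
def IsHomOn.comp {f : HeytingHom A (C n)} {e : C n → C n} (he : IsHomOn (Set.range f) e) :
    HeytingHom A (C n) where
  toFun a := e (f a)
  map_sup' a b := by
    rw [map_sup]
    rcases le_total (f a) (f b) with h | h
    · rw [sup_eq_right.2 h, sup_eq_right.2 (he.le ⟨a, rfl⟩ ⟨b, rfl⟩ h)]
    · rw [sup_eq_left.2 h, sup_eq_left.2 (he.le ⟨b, rfl⟩ ⟨a, rfl⟩ h)]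
  map_inf' a b := by
    rw [map_inf]
    rcases le_total (f a) (f b) with h | h
    · rw [inf_eq_left.2 h, inf_eq_left.2 (he.le ⟨a, rfl⟩ ⟨b, rfl⟩ h)]
    · rw [inf_eq_right.2 h, inf_eq_right.2 (he.le ⟨b, rfl⟩ ⟨a, rfl⟩ h)]
  map_bot' := by rw [map_bot, he.bot]
  map_himp' a b := by
    rw [map_himp]
    rcases le_or_gt (f a) (f b) with h | h
    · rw [himp_eq_top_iff.2 h, himp_eq_top_iff.2 (he.le ⟨a, rfl⟩ ⟨b, rfl⟩ h), he.top]
    · rw [C_himp, if_neg h.not_ge, C_himp]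
      rcases he.lt _ ⟨b, rfl⟩ _ ⟨a, rfl⟩ h with h' | ⟨h₁, h₂⟩
      · rw [if_neg h'.not_ge]
      · rw [h₁, h₂, if_pos le_rfl]

@[simp]
theorem IsHomOn.comp_apply {f : HeytingHom A (C n)} {e : C n → C n}
    (he : IsHomOn (Set.range f) e) (a : A) : he.comp a = e (f a) := rfl

/-- A homomorphism into the chain factors through any homomorphism with a smaller kernel. -/
theorem exists_isHomOn_factor (f g : HeytingHom A (C n)) (h : ∀ a, f a = ⊤ → g a = ⊤) :
    ∃ e : C n → C n, IsHomOn (Set.range f) e ∧ ∀ a, g a = e (f a) := by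
  have key : ∀ a b, f a ≤ f b → g a ≤ g b := fun a b hab => by
    rw [← himp_eq_top_iff, ← map_himp]
    exact h _ (by rw [map_himp, himp_eq_top_iff.2 hab])
  have hfac : Function.FactorsThrough g f := fun a b hab =>
    le_antisymm (key a b hab.le) (key b a hab.ge)
  have he : ∀ a, Function.extend f g id (f a) = g a := hfac.extend_apply id
  refine ⟨Function.extend f g id, ⟨?_, ?_, ?_⟩, fun a => (he a).symm⟩
  · rw [← map_bot f, he, map_bot, map_bot]
  · rw [← map_top f, he, map_top, map_top]
  · rintro _ ⟨a, rfl⟩ _ ⟨b, rfl⟩ hab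
    rw [he, he]
    -- This gives strictness below `⊤`: if also `g a = g b`, then `g a = g b ⇨ g a = ⊤`.
    have h₁ : g (b ⇨ a) = g a := by
      have h₂ : f (b ⇨ a) = f a := by rw [map_himp, C_himp, if_neg hab.not_ge]
      exact le_antisymm (key _ _ h₂.le) (key _ _ h₂.ge)
    rcases (key a b hab.le).lt_or_eq with h' | h'
    · exact .inl h'
    · have h₃ : g a = ⊤ := by rw [← h₁, map_himp, h', himp_self]
      exact .inr ⟨h₃, by rw [← h', h₃]⟩

end Homs

section Structures

variable {I : Type w} {M : Type v} [HeytingAlgebra M] {R : I → PartialEnd M}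

theorem TopStr.mem_pow_op {Y : TopStr.{v} I} {S : Type u} {i : I} {x x' : (Y.pow S).carrier} :
    x' ∈ (Y.pow S).op i x ↔ ∀ s, x' s ∈ Y.op i (x s) := by
  constructor
  · rintro ⟨h, rfl⟩ s
    exact Part.get_mem (h s)
  · intro h
    exact ⟨fun s => (h s).1, funext fun s => (h s).2⟩

theorem TopStr.mem_sub_op {Y : TopStr.{v} I} {X : Set Y.carrier} {hX : Y.IsSub X} {i : I}
    {x x' : (Y.sub X hX).carrier} : x' ∈ (Y.sub X hX).op i x ↔ x'.1 ∈ Y.op i x.1 := by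
  constructor
  · rintro ⟨h, rfl⟩
    exact Part.get_mem (o := Y.op i x.1) h
  · rintro ⟨h, h'⟩
    exact ⟨h, Subtype.ext h'⟩

theorem TopStr.continuous_coord {Y : TopStr.{v} I} {S : Type u} {Z : Set (Y.pow S).carrier}
    {hZ : (Y.pow S).IsSub Z} (s : S) :
    Continuous fun x : ((Y.pow S).sub Z hZ).carrier => x.1 s :=
  have h : Continuous fun x : (Y.pow S).carrier => x s := continuous_apply s
  h.comp (continuous_subtype_val (X := (Y.pow S).carrier) (p := fun z => z ∈ Z))

instance (Y : TopStr.{v} I) [Finite Y.carrier] (S : Type u) :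
    CompactSpace (Y.pow S).carrier :=
  inferInstanceAs (CompactSpace (S → Y.carrier))

instance [Finite M] : Finite (alterEgo R).carrier := inferInstanceAs (Finite M)

instance (S : Type u) : T2Space ((alterEgo R).pow S).carrier :=
  inferInstanceAs (T2Space (S → (alterEgo R).carrier))

instance (A : Type u) [HeytingAlgebra A] : T2Space (D R A).carrier :=
  inferInstanceAs (T2Space (homSet R A))

theorem isClosed_homSet (A : Type u) [HeytingAlgebra A] : IsClosed (homSet R A) := by
  have h : homSet R A =
      (⋂ (a : A) (b : A), {x | ((x a, x b, x (a ⊔ b)) :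
        (alterEgo R).carrier × (alterEgo R).carrier × (alterEgo R).carrier) ∈
          {p : M × M × M | p.2.2 = p.1 ⊔ p.2.1}}) ∩
      (⋂ (a : A) (b : A), {x | ((x a, x b, x (a ⊓ b)) :
        (alterEgo R).carrier × (alterEgo R).carrier × (alterEgo R).carrier) ∈
          {p : M × M × M | p.2.2 = p.1 ⊓ p.2.1}}) ∩
      (⋂ (a : A) (b : A), {x | ((x a, x b, x (a ⇨ b)) :
        (alterEgo R).carrier × (alterEgo R).carrier × (alterEgo R).carrier) ∈
          {p : M × M × M | p.2.2 = p.1 ⇨ p.2.1}}) ∩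
      {x | x ⊥ ∈ ({⊥} : Set M)} := by
    ext x
    simp only [Set.mem_inter_iff, Set.mem_iInter]
    constructor
    · rintro ⟨f, hf⟩
      refine ⟨⟨⟨fun a b => ?_, fun a b => ?_⟩, fun a b => ?_⟩, ?_⟩
      · change x (a ⊔ b) = (x a ⊔ x b : M)
        rw [hf, hf, hf]; exact map_sup (β := M) f a b
      · change x (a ⊓ b) = (x a ⊓ x b : M)
        rw [hf, hf, hf]; exact map_inf (β := M) f a b
      · change x (a ⇨ b) = (x a ⇨ x b : M)
        rw [hf, hf, hf]; exact map_himp (β := M) f a b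
      · change x ⊥ = (⊥ : M)
        rw [hf]; exact map_bot (β := M) f
    · rintro ⟨⟨⟨h₁, h₂⟩, h₃⟩, h₄⟩
      exact ⟨{ toFun := x, map_sup' := h₁, map_inf' := h₂, map_himp' := h₃, map_bot' := h₄ },
        fun a => rfl⟩
  have hc : ∀ (a b c : A), Continuous fun x : ((alterEgo R).pow A).carrier =>
      ((x a, x b, x c) : (alterEgo R).carrier × (alterEgo R).carrier × (alterEgo R).carrier) :=
    fun a b c => (continuous_apply a).prodMk ((continuous_apply b).prodMk (continuous_apply c))
  rw [h]
  refine (((isClosed_iInter fun a => isClosed_iInter fun b => ?_).inter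
    (isClosed_iInter fun a => isClosed_iInter fun b => ?_)).inter
    (isClosed_iInter fun a => isClosed_iInter fun b => ?_)).inter ?_
  · exact (isClosed_discrete _).preimage (hc _ _ _)
  · exact (isClosed_discrete _).preimage (hc _ _ _)
  · exact (isClosed_discrete _).preimage (hc _ _ _)
  · exact (isClosed_discrete (α := (alterEgo R).carrier) _).preimage (continuous_apply (⊥ : A))

instance [Finite M] (A : Type u) [HeytingAlgebra A] : CompactSpace (D R A).carrier :=
  isCompact_iff_compactSpace.1 (isClosed_homSet (R := R) A).isCompact

/-- The homomorphism underlying a point of the dual `D(A)`. -/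
noncomputable def homOf {A : Type u} [HeytingAlgebra A] (x : (D R A).carrier) : HeytingHom A M :=
  x.2.choose

theorem homOf_apply {A : Type u} [HeytingAlgebra A] (x : (D R A).carrier) (a : A) :
    homOf x a = x.1 a :=
  (x.2.choose_spec a).symm

/-- The point of the dual `D(A)` given by a homomorphism. -/
def ofHom (R : I → PartialEnd M) {A : Type u} [HeytingAlgebra A] (f : HeytingHom A M) :
    (D R A).carrier :=
  ⟨fun a => f a, f, fun _ => rfl⟩

/-- Transfers `IsHomOn.induction` to powers: each generating step is a pointwise operation, under
which `Z` is closed. -/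
theorem isHomOn_mem {n : ℕ} [NeZero n] (hn : 4 ≤ n) {S : Type u}
    {Z : Set ((alterEgo (gh₁ n hn)).pow S).carrier} (hZ : ((alterEgo (gh₁ n hn)).pow S).IsSub Z)
    {K : Set (C n)} (hbot : ⊥ ∈ K) {e : C n → C n} (he : IsHomOn K e) {x : S → C n}
    (hx : x ∈ Z) (hxK : ∀ s, x s ∈ K) : (fun s => e (x s)) ∈ Z := by
  classical
  refine IsHomOn.induction hn (R := K.toFinset) (P := fun e => (fun s => e (x s)) ∈ Z)
    ?_ ?_ hx (Set.mem_toFinset.2 hbot) (by rwa [Set.coe_toFinset])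
  · intro i e e' h h'
    exact hZ i _ h _ (TopStr.mem_pow_op.2 fun s => h' _ (Set.mem_toFinset.2 (hxK s)))
  · intro e e' h h'
    have : (fun s => e' (x s)) = fun s => e (x s) :=
      funext fun s => h' _ (Set.mem_toFinset.2 (hxK s))
    rwa [this]

end Structures

end GodelDuality

namespace GodelDuality

/-! ### Evaluations and compactness -/

section Evaluation

variable {I : Type w} {M : Type v} [HeytingAlgebra M] {R : I → PartialEnd M} {X : TopStr.{u} I}

/-- Evaluation at a point `x`, as a homomorphism `E(X) → M`. -/
def pointHom (R : I → PartialEnd M) (x : X.carrier) : HeytingHom (E R X) M where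
  toFun f := f.val x
  map_sup' _ _ := rfl
  map_inf' _ _ := rfl
  map_bot' := rfl
  map_himp' _ _ := rfl

theorem continuous_ofHom_pointHom :
    Continuous fun x : X.carrier => ofHom R (pointHom R x) :=
  have h : Continuous fun (x : X.carrier) (f : E R X) => f.toFun x :=
    continuous_pi fun f => f.continuous_toFun
  h.subtype_mk _

/-- Every homomorphism from `E(X)` into the chain, for `X` compact, has a larger kernel than some
evaluation. -/
theorem exists_pointHom_ker_le {n : ℕ} [NeZero n] {R : I → PartialEnd (C n)}
    [CompactSpace X.carrier] (hn : 2 ≤ n) (g : HeytingHom (E R X) (C n)) :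
    ∃ x : X.carrier, ∀ f, pointHom R x f = ⊤ → g f = ⊤ := by
  by_contra! hne
  -- Local witnesses are joined over a finite cover. The join still avoids `⊤` under `g`, since `⊤`
  -- is join-irreducible in a chain.
  obtain ⟨f, hf, hgf⟩ : ∃ f : E R X, (∀ y ∈ (Set.univ : Set X.carrier), f.val y = ⊤) ∧ g f ≠ ⊤ := by
    refine isCompact_univ.induction_on
      (p := fun s => ∃ f : E R X, (∀ y ∈ s, f.val y = ⊤) ∧ g f ≠ ⊤) ?_ ?_ ?_ ?_
    · refine ⟨⊥, fun _ h => h.elim, ?_⟩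
      rw [map_bot, Ne, C_eq_top_iff]
      change ¬ 0 = n - 1
      omega
    · rintro s t hst ⟨f, hf, hgf⟩
      exact ⟨f, fun y hy => hf y (hst hy), hgf⟩
    · rintro s t ⟨f, hf, hgf⟩ ⟨f', hf', hgf'⟩
      refine ⟨f ⊔ f', ?_, ?_⟩
      · rintro y (hy | hy)
        · change f.val y ⊔ f'.val y = ⊤
          rw [hf y hy, top_sup_eq]
        · change f.val y ⊔ f'.val y = ⊤
          rw [hf' y hy, sup_top_eq]
      · rw [map_sup]
        rcases le_total (g f) (g f') with h | h
        · rwa [sup_eq_right.2 h]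
        · rwa [sup_eq_left.2 h]
    · intro x _
      obtain ⟨f, hf, hgf⟩ := hne x
      refine ⟨{y | f.val y = ⊤}, mem_nhdsWithin_of_mem_nhds ?_, f, fun y hy => hy, hgf⟩
      exact ((isOpen_discrete ({⊤} : Set (alterEgo R).carrier)).preimage
        f.continuous_toFun).mem_nhds hf
  refine hgf ?_
  have : f = ⊤ := E.val_injective (funext fun y => hf y trivial)
  rw [this, map_top]

end Evaluation

/-! ### Full duality for the tuple `(g_1, …, g_{n-3}, h_1)` -/

section Chain

variable {n : ℕ} [NeZero n] (hn : 4 ≤ n)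

/-- The isomorphism is inverse to evaluation. Coordinate projections are morphisms, so they separate
points and detect the operations. -/
theorem nonempty_iso_of_inIScP {X : TopStr.{u} (Idx n)}
    (hX : TopStr.InIScP.{u} (alterEgo (gh₁ n hn)) X) :
    Nonempty ((D (gh₁ n hn) (E (gh₁ n hn) X)).Iso X) := by
  obtain ⟨S, Z, hZ, hcl, ⟨Θ⟩⟩ := hX
  have : CompactSpace (((alterEgo (gh₁ n hn)).pow S).sub Z hZ).carrier :=
    isCompact_iff_compactSpace.1 hcl.isCompact
  have : CompactSpace X.carrier := Θ.toHomeomorph.symm.compactSpace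
  let proj : S → E (gh₁ n hn) X := fun s =>
    { toFun := fun x => (Θ.toHomeomorph x).1 s
      continuous_toFun := (TopStr.continuous_coord s).comp Θ.toHomeomorph.continuous
      map_op := fun i x x' h =>
        TopStr.mem_pow_op.1 (TopStr.mem_sub_op.1 ((Θ.map_op_iff i x x').2 h)) s }
  have proj_apply : ∀ s x, (proj s).toFun x = (Θ.toHomeomorph x).1 s := fun _ _ => rfl
  let ev : X.carrier → (D (gh₁ n hn) (E (gh₁ n hn) X)).carrier :=
    fun x => ofHom (gh₁ n hn) (pointHom _ x)
  have ev_apply : ∀ x f, (ev x).1 f = f.toFun x := fun _ _ => rfl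
  have ev_inj : Function.Injective ev := fun x y h => by
    refine Θ.toHomeomorph.injective (Subtype.ext (funext fun s => ?_))
    rw [← proj_apply, ← ev_apply, h, ev_apply, proj_apply]
  have ev_surj : Function.Surjective ev := by
    intro g
    obtain ⟨x, hx⟩ := exists_pointHom_ker_le (by omega) (homOf g)
    obtain ⟨e, he, hge⟩ := exists_isHomOn_factor _ _ hx
    -- The evaluations form a substructure: an operation defined at one is defined on every
    -- projection, hence at the underlying point of `X`. So `W` is closed under `e`, making `g` an
    -- evaluation.
    let W : Set ((alterEgo (gh₁ n hn)).pow (E (gh₁ n hn) X)).carrier :=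
      {z | ∃ y, ∀ f : E (gh₁ n hn) X, z f = f.toFun y}
    have hW : ((alterEgo (gh₁ n hn)).pow (E (gh₁ n hn) X)).IsSub W := by
      rintro i z ⟨y, hy⟩ z' hz'
      rw [TopStr.mem_pow_op] at hz'
      let w : ((alterEgo (gh₁ n hn)).pow S).carrier := fun s => z' (proj s)
      have hw : w ∈ ((alterEgo (gh₁ n hn)).pow S).op i (Θ.toHomeomorph y).1 := by
        refine TopStr.mem_pow_op.2 fun s => ?_
        rw [← proj_apply, ← hy]
        exact hz' (proj s)
      have hwZ : w ∈ Z := hZ i _ (Θ.toHomeomorph y).2 _ hw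
      refine ⟨Θ.toHomeomorph.symm ⟨w, hwZ⟩, fun f => ?_⟩
      have hop : Θ.toHomeomorph.symm ⟨w, hwZ⟩ ∈ X.op i y := by
        refine (Θ.map_op_iff i _ _).1 (TopStr.mem_sub_op.2 ?_)
        have h := Θ.toHomeomorph.apply_symm_apply ⟨w, hwZ⟩
        exact (congrArg Subtype.val h).symm ▸ hw
      have h := hz' f
      rw [hy] at h
      exact Part.mem_unique h (f.map_op i _ _ hop)
    obtain ⟨y, hy⟩ := isHomOn_mem hn hW (K := Set.range (pointHom (gh₁ n hn) x))
      ⟨⊥, map_bot _⟩ he (x := pointHom (gh₁ n hn) x) ⟨x, fun _ => rfl⟩ (fun f => ⟨f, rfl⟩)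
    refine ⟨y, Subtype.ext (funext fun f => ?_)⟩
    exact (hy f).symm.trans ((hge f).symm.trans (homOf_apply g f))
  let H : X.carrier ≃ₜ (D (gh₁ n hn) (E (gh₁ n hn) X)).carrier :=
    Continuous.homeoOfEquivCompactToT2 (f := Equiv.ofBijective ev ⟨ev_inj, ev_surj⟩)
      continuous_ofHom_pointHom
  have hH : ∀ x, H x = ev x := fun _ => rfl
  refine ⟨⟨H.symm, fun i g g' => ?_⟩⟩
  obtain ⟨x, rfl⟩ := H.surjective g
  obtain ⟨x', rfl⟩ := H.surjective g'
  rw [Homeomorph.symm_apply_apply, Homeomorph.symm_apply_apply, hH, hH]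
  refine Iff.trans ?_ (TopStr.mem_sub_op.trans TopStr.mem_pow_op).symm
  constructor
  · exact fun h f => f.map_op i x x' h
  · intro h
    rw [← Θ.map_op_iff]
    exact TopStr.mem_sub_op.2 (TopStr.mem_pow_op.2 fun s => h (proj s))

variable {A : Type u} [HeytingAlgebra A]

/-- Morphisms from a dual into the alter ego commute with all homomorphisms between subalgebras of
the chain. -/
theorem toFun_isHomOn (φ : E (gh₁ n hn) (D (gh₁ n hn) A)) {x y : (D (gh₁ n hn) A).carrier}
    {K : Set (C n)} {e : C n → C n} (he : IsHomOn K e) (hK : ∀ a, x.1 a ∈ K)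
    (hφ : φ.val x ∈ K) (hy : ∀ a, y.1 a = e (x.1 a)) : φ.val y = e (φ.val x) := by
  -- The graph of `φ`, with its value stored in the coordinate `none`, is a substructure because `φ`
  -- is a morphism.
  let W : Set ((alterEgo (gh₁ n hn)).pow (Option A)).carrier :=
    {z | ∃ y : (D (gh₁ n hn) A).carrier, (∀ a, z (some a) = y.1 a) ∧ z none = φ.toFun y}
  have hW : ((alterEgo (gh₁ n hn)).pow (Option A)).IsSub W := by
    rintro i z ⟨y, hy, hy'⟩ z' hz'
    rw [TopStr.mem_pow_op] at hz'
    let w : ((alterEgo (gh₁ n hn)).pow A).carrier := fun a => z' (some a)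
    have hw : w ∈ ((alterEgo (gh₁ n hn)).pow A).op i y.1 :=
      TopStr.mem_pow_op.2 fun a => hy a ▸ hz' (some a)
    have hwA : w ∈ homSet (gh₁ n hn) A := homSet_isSub _ A i _ y.2 _ hw
    refine ⟨⟨w, hwA⟩, fun _ => rfl, ?_⟩
    have hop : (⟨w, hwA⟩ : (D (gh₁ n hn) A).carrier) ∈ (D (gh₁ n hn) A).op i y :=
      TopStr.mem_sub_op.2 hw
    have h := hz' none
    rw [hy'] at h
    exact Part.mem_unique h (φ.map_op i _ _ hop)
  have hbot : ⊥ ∈ K := by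
    have := hK ⊥
    rwa [← homOf_apply, map_bot] at this
  obtain ⟨y', h, h'⟩ := isHomOn_mem hn hW hbot he
    (x := fun o => o.elim (φ.val x) x.1) ⟨x, fun _ => rfl, rfl⟩ (by
      rintro (_ | a)
      · exact hφ
      · exact hK a)
  have hyy : y' = y := Subtype.ext (funext fun a => by rw [← h a, hy a]; rfl)
  rw [hyy] at h'
  exact h'.symm

/-- The value of a morphism from a dual at a homomorphism lies in the range of that homomorphism. -/
theorem val_mem_range (φ : E (gh₁ n hn) (D (gh₁ n hn) A)) (x : (D (gh₁ n hn) A).carrier) :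
    ∃ a, homOf x a = φ.val x := by
  by_contra! hne
  have hne' : ∀ a, x.1 a ≠ φ.val x := fun a => by
    rw [← homOf_apply]
    exact hne a
  have h0 : (φ.val x).val ≠ 0 := fun h => hne ⊥ (by rw [map_bot, (C_eq_bot_iff _).2 h])
  have h1 : (φ.val x).val ≠ n - 1 := fun h => hne ⊤ (by rw [map_top, (C_eq_top_iff _).2 h])
  have hlt := (φ.val x).2
  by_cases h2 : (φ.val x).val = n - 2
  -- No `g_i` omits `n - 2` from its domain, so an endomorphism collapsing it is used: it fixes `x`,
  -- whose range misses `n - 2`, but would move `φ x`.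
  · let κ : C n → C n := fun c => if c.val = n - 2 then ⊤ else c
    have hκ : IsHomOn Set.univ κ := by
      refine ⟨?_, ?_, fun a _ b _ hab => ?_⟩
      · exact if_neg (by change ¬ 0 = n - 2; omega)
      · exact if_neg (by rw [Fin.val_top]; omega)
      · have hab' : a.val < b.val := hab
        have := b.2
        by_cases ha : a.val = n - 2
        · have hb : b = ⊤ := (C_eq_top_iff b).2 (by omega)
          refine .inr ⟨if_pos ha, ?_⟩
          rw [hb]
          exact ite_self _
        · left
          rw [show κ a = a from if_neg ha]
          by_cases hb : b.val = n - 2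
          · rw [show κ b = ⊤ from if_pos hb]
            exact hab.trans_le le_top
          · rwa [show κ b = b from if_neg hb]
    have h := toFun_isHomOn hn φ (x := x) (y := x) hκ (fun _ => trivial) trivial fun a => by
      refine (if_neg fun h => hne' a ?_).symm
      exact Fin.ext (h.trans h2.symm)
    rw [show κ (φ.val x) = ⊤ from if_pos h2, C_eq_top_iff] at h
    exact h1 h
  -- With `i = φ x` outside the range of `x`, `g_i` is defined at `x` but not at `φ x`.
  · let i : Set.Icc 1 (n - 3) := ⟨(φ.val x).val, by omega, by omega⟩
    have hdom : ((D (gh₁ n hn) A).op (Sum.inl i) x).Dom :=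
      fun a h => hne' a (Fin.ext h)
    exact (φ.map_op _ _ _ (Part.get_mem hdom)).1 rfl

/-- Interpolation of a morphism from a dual on pairs of points. -/
theorem exists_interpolant (φ : E (gh₁ n hn) (D (gh₁ n hn) A))
    (x y : (D (gh₁ n hn) A).carrier) :
    ∃ a, φ.val x ≤ homOf x a ∧ homOf y a ≤ φ.val y := by
  by_contra! hne
  obtain ⟨a, ha⟩ := val_mem_range hn φ x
  have hy : φ.val y ≠ ⊤ := fun h => by
    have := hne a ha.ge
    rw [h] at this
    exact this.not_ge le_top
  -- If interpolation fails, everything `x` sends to `⊤` is sent above `φ y` by `y`, so `c ∘ y`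
  -- factors as `e ∘ x`. Computing `φ` at this point both ways gives `c (φ y) = e (φ x) = ⊤`,
  -- although `c` fixes `φ y ≠ ⊤`.
  let c : C n → C n := fun r => if φ.val y < r then ⊤ else r
  have c_top : ∀ r, c r = ⊤ → φ.val y < r := fun r h => by
    by_contra hr
    have hc : c r = r := if_neg hr
    rw [hc] at h
    exact hr (h ▸ hy.lt_top)
  have hc : IsHomOn Set.univ c := by
    refine ⟨if_neg not_lt_bot, ?_, fun r _ s _ hrs => ?_⟩
    · by_cases h : φ.val y < ⊤
      · exact if_pos h
      · exact if_neg h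
    · by_cases hr : φ.val y < r
      · exact .inr ⟨if_pos hr, if_pos (hr.trans hrs)⟩
      · left
        have hcr : c r = r := if_neg hr
        rw [hcr]
        by_cases hs : φ.val y < s
        · have hcs : c s = ⊤ := if_pos hs
          rw [hcs]
          exact hrs.trans_le le_top
        · have hcs : c s = s := if_neg hs
          rwa [hcs]
  have hc' := hc.mono (Set.subset_univ (Set.range (homOf y)))
  obtain ⟨e, he, hge⟩ := exists_isHomOn_factor (homOf x) hc'.comp fun b hb => by
    have : φ.val y < homOf y b := hne b (by rw [hb]; exact le_top)
    exact if_pos this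
  have h₁ : φ.val (ofHom _ hc'.comp) = c (φ.val y) :=
    toFun_isHomOn hn φ hc (fun _ => trivial) trivial fun b => by
      rw [← homOf_apply y]; rfl
  have h₂ : φ.val (ofHom _ hc'.comp) = e (φ.val x) :=
    toFun_isHomOn hn φ he (fun b => ⟨b, homOf_apply x b⟩) ⟨a, ha⟩ fun b => by
      rw [← homOf_apply x]; exact hge b
  have h₃ : e (φ.val x) = ⊤ := by
    rw [← ha, ← hge]
    exact if_pos (hne a ha.ge)
  exact lt_irrefl _ (c_top (φ.val y) (by rw [← h₁, h₂, h₃]))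

/-- The lattice Stone–Weierstrass argument: finite meets of the two-point interpolants bring them
below `φ` everywhere, and finite joins of these then reach `φ`. -/
theorem evalHom_surjective : Function.Surjective (evalHom (gh₁ n hn) A) := by
  intro φ
  have hcont : ∀ a, Continuous fun y : (D (gh₁ n hn) A).carrier =>
      ((y.1 a, φ.toFun y) : (alterEgo (gh₁ n hn)).carrier × (alterEgo (gh₁ n hn)).carrier) :=
    fun a => (TopStr.continuous_coord a).prodMk φ.continuous_toFun
  have hsup : ∀ (x : (D (gh₁ n hn) A).carrier) a b, homOf x (a ⊔ b) = homOf x a ⊔ homOf x b :=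
    fun x a b => map_sup (homOf x) a b
  have hinf : ∀ (x : (D (gh₁ n hn) A).carrier) a b, homOf x (a ⊓ b) = homOf x a ⊓ homOf x b :=
    fun x a b => map_inf (homOf x) a b
  have step : ∀ x, ∃ a, φ.val x ≤ homOf x a ∧ ∀ y ∈ Set.univ, homOf y a ≤ φ.val y := by
    intro x
    refine isCompact_univ.induction_on
      (p := fun s => ∃ a, φ.val x ≤ homOf x a ∧ ∀ y ∈ s, homOf y a ≤ φ.val y) ?_ ?_ ?_ ?_
    · exact ⟨⊤, by rw [map_top]; exact le_top, fun _ h => h.elim⟩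
    · rintro s t hst ⟨a, ha, ha'⟩
      exact ⟨a, ha, fun y hy => ha' y (hst hy)⟩
    · rintro s t ⟨a, ha, ha'⟩ ⟨b, hb, hb'⟩
      refine ⟨a ⊓ b, by rw [hinf]; exact le_inf ha hb, ?_⟩
      rintro y (hy | hy) <;> rw [hinf]
      · exact inf_le_left.trans (ha' y hy)
      · exact inf_le_right.trans (hb' y hy)
    · intro y _
      obtain ⟨a, ha, ha'⟩ := exists_interpolant hn φ x y
      refine ⟨{z | homOf z a ≤ φ.val z}, mem_nhdsWithin_of_mem_nhds ?_, a, ha, fun z hz => hz⟩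
      simp only [homOf_apply] at ha' ⊢
      exact ((isOpen_discrete {p : C n × C n | p.1 ≤ p.2}).preimage (hcont a)).mem_nhds ha'
  obtain ⟨a, ha, ha'⟩ : ∃ a, (∀ y, homOf y a ≤ φ.val y) ∧ ∀ x ∈ Set.univ, φ.val x ≤ homOf x a := by
    refine isCompact_univ.induction_on
      (p := fun s => ∃ a, (∀ y, homOf y a ≤ φ.val y) ∧ ∀ x ∈ s, φ.val x ≤ homOf x a) ?_ ?_ ?_ ?_
    · exact ⟨⊥, fun y => by rw [map_bot]; exact bot_le, fun _ h => h.elim⟩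
    · rintro s t hst ⟨a, ha, ha'⟩
      exact ⟨a, ha, fun y hy => ha' y (hst hy)⟩
    · rintro s t ⟨a, ha, ha'⟩ ⟨b, hb, hb'⟩
      refine ⟨a ⊔ b, fun y => by rw [hsup]; exact sup_le (ha y) (hb y), ?_⟩
      rintro y (hy | hy) <;> rw [hsup]
      · exact (ha' y hy).trans le_sup_left
      · exact (hb' y hy).trans le_sup_right
    · intro x _
      obtain ⟨a, ha, ha'⟩ := step x
      refine ⟨{z | φ.val z ≤ homOf z a}, mem_nhdsWithin_of_mem_nhds ?_, a,
        fun y => ha' y trivial, fun z hz => hz⟩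
      simp only [homOf_apply] at ha ⊢
      exact ((isOpen_discrete {p : C n × C n | p.2 ≤ p.1}).preimage (hcont a)).mem_nhds ha
  refine ⟨a, E.val_injective (funext fun x => ?_)⟩
  exact (homOf_apply x a).symm.trans (le_antisymm (ha x) (ha' x trivial))

end Chain

theorem evalHom_injective {I : Type w} {M : Type v} [HeytingAlgebra M] (R : I → PartialEnd M)
    {A : Type u} [HeytingAlgebra A] (hA : InISP M A) : Function.Injective (evalHom R A) := by
  obtain ⟨S, f, hf⟩ := hA
  intro a b hab
  refine hf (funext fun s => ?_)
  let g : HeytingHom A M :=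
    { toFun := fun a => f a s
      map_sup' := fun a b => by rw [map_sup]; rfl
      map_inf' := fun a b => by rw [map_inf]; rfl
      map_bot' := by rw [map_bot]; rfl
      map_himp' := fun a b => by rw [map_himp]; rfl }
  exact congrFun (congrArg E.val hab) (ofHom R g)

theorem fullyDualises_gh₁ {n : ℕ} [NeZero n] (hn : 4 ≤ n) : FullyDualises.{u} (gh₁ n hn) :=
  ⟨fun _ _ hA => ⟨evalHom_injective _ hA, evalHom_surjective hn⟩,
    fun _ hX => nonempty_iso_of_inIScP hn hX⟩

end GodelDuality

namespace GodelDuality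

/-! ### Small closed substructures that are not duals -/

section Structures

variable {I : Type w}

/-- The inverse of an isomorphism of structures. -/
def TopStr.Iso.symm {X : TopStr.{u} I} {Y : TopStr.{v} I} (Θ : X.Iso Y) : Y.Iso X where
  toHomeomorph := Θ.toHomeomorph.symm
  map_op_iff i x x' := by
    rw [← Θ.map_op_iff, Homeomorph.apply_symm_apply, Homeomorph.apply_symm_apply]

/-- The composite of two isomorphisms of structures. -/
def TopStr.Iso.trans {X : TopStr.{u} I} {Y : TopStr.{v} I} {Z : TopStr I} (Θ : X.Iso Y)
    (Ψ : Y.Iso Z) : X.Iso Z where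
  toHomeomorph := Θ.toHomeomorph.trans Ψ.toHomeomorph
  map_op_iff _ _ _ := (Ψ.map_op_iff _ _ _).trans (Θ.map_op_iff _ _ _)

/-- A closed non-dual substructure refutes full duality. -/
theorem IsClosedNonDual.not_fullyDualises {M : Type v} [HeytingAlgebra M] {R : I → PartialEnd M}
    {X : Set M} (h : IsClosedNonDual.{max u v} R X) : ¬ FullyDualises.{u} R := by
  rintro ⟨-, hR⟩
  obtain ⟨hcl, hX, hE⟩ := h
  -- A one-fold power places `X` in the class and in the universe that full duality quantifies over.
  let Y := (alterEgo R).pow PUnit.{u + 1}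
  let Z : Set Y.carrier := {z | z PUnit.unit ∈ X}
  have hZ : Y.IsSub Z := fun i x hx x' hx' => hX i _ hx _ (TopStr.mem_pow_op.1 hx' _)
  have hZcl : IsClosed Z := hcl.preimage (continuous_apply PUnit.unit)
  let Θ : ((alterEgo R).sub X hX).Iso (Y.sub Z hZ) :=
    { toHomeomorph :=
        { toFun := fun x => ⟨fun _ => x.1, x.2⟩
          invFun := fun z => ⟨z.1 PUnit.unit, z.2⟩
          left_inv := fun _ => rfl
          right_inv := fun _ => rfl
          continuous_toFun := (continuous_pi fun _ => continuous_subtype_val).subtype_mk _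
          continuous_invFun :=
            (TopStr.continuous_coord PUnit.unit).subtype_mk _ }
      map_op_iff := fun i x x' => by
        refine (TopStr.mem_sub_op.trans TopStr.mem_pow_op).trans (Iff.trans ?_
          (TopStr.mem_sub_op (Y := alterEgo R)).symm)
        exact ⟨fun h => h PUnit.unit, fun h _ => h⟩ }
  have refl : (Y.sub Z hZ).Iso (Y.sub Z hZ) := ⟨Homeomorph.refl _, fun _ _ _ => Iff.rfl⟩
  obtain ⟨Ψ⟩ := hR (Y.sub Z hZ) ⟨PUnit, Z, hZ, hZcl, ⟨refl⟩⟩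
  refine (hE (E R (Y.sub Z hZ)) ⟨(Y.sub Z hZ).carrier,
    { toFun := E.val
      map_sup' := fun _ _ => rfl
      map_inf' := fun _ _ => rfl
      map_bot' := rfl
      map_himp' := fun _ _ => rfl }, E.val_injective⟩).false (Θ.trans Ψ.symm)

end Structures

section Chain

variable {n : ℕ} [NeZero n]

/-- If some homomorphism `A → C_n` takes a value other than `⊥` and `⊤`, then there are at least
`n - 1` homomorphisms `A → C_n`. -/
theorem exists_injective_of_ne {A : Type u} [HeytingAlgebra A] {f : HeytingHom A (C n)} {a : A}
    (h0 : f a ≠ ⊥) (h1 : f a ≠ ⊤) :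
    ∃ F : {v : C n // v ≠ ⊥} → HeytingHom A (C n), Function.Injective F := by
  classical
  -- Take the least nonzero value `m` of `f`, which lies below `⊤`. Sending it to any `v ≠ ⊥` and
  -- everything above it to `⊤` is a homomorphism on the range.
  obtain ⟨m, ⟨⟨b, hb⟩, hm0⟩, hmin⟩ := exists_minimal_of_wellFoundedLT
    (fun r => r ∈ Set.range f ∧ r ≠ ⊥) ⟨f a, ⟨a, rfl⟩, h0⟩
  have hm1 : m ≠ ⊤ := by
    rintro rfl
    exact h1 (top_le_iff.1 (hmin ⟨⟨a, rfl⟩, h0⟩ le_top))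
  have hbt : (⊥ : C n) ≠ ⊤ := fun h => h0 (le_bot_iff.1 (h ▸ le_top))
  have key : ∀ v : {v : C n // v ≠ ⊥}, IsHomOn (Set.range f)
      (fun r => if r = ⊥ then ⊥ else if r = m then v.1 else ⊤) := by
    intro v
    refine ⟨by simp, by simp [hbt.symm, hm1.symm], fun r hr s hs hrs => ?_⟩
    have hs0 : s ≠ ⊥ := (bot_le.trans_lt hrs).ne'
    rw [if_neg hs0]
    by_cases hr0 : r = ⊥
    · left
      rw [if_pos hr0, bot_lt_iff_ne_bot]
      split_ifs
      · exact v.2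
      · exact hbt.symm
    · have hms : m ≠ s := by
        rintro rfl
        exact hrs.not_ge (hmin ⟨hr, hr0⟩ hrs.le)
      rw [if_neg hr0, if_neg hms.symm]
      split_ifs
      · rcases (le_top : v.1 ≤ ⊤).lt_or_eq with h | h
        · exact .inl h
        · exact .inr ⟨h, rfl⟩
      · exact .inr ⟨rfl, rfl⟩
  refine ⟨fun v => (key v).comp, fun v w hvw => Subtype.ext ?_⟩
  have := DFunLike.congr_fun hvw b
  simpa [hb, hm0] using this

/-- A substructure of the chain with fewer than `n - 1` elements on which some operation is not
total is not the dual of any algebra. -/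
theorem isClosedNonDual_of_card {I : Type w} {R : I → PartialEnd (C n)} {X : Set (C n)}
    (hX : ∀ i, ∀ x ∈ X, ∀ x' ∈ (R i).toPFun x, x' ∈ X) (hcard : X.ncard < n - 1)
    {i : I} {x : C n} (hx : x ∈ X)
    (hi : ¬ ((R i).toPFun x).Dom) : IsClosedNonDual.{u} R X := by
  classical
  refine ⟨isClosed_discrete _, hX, fun A _ _ => ⟨fun Θ => ?_⟩⟩
  let y := Θ.toHomeomorph ⟨x, hx⟩
  -- A two-valued homomorphism is fixed by every operation, whereas operation `i` is undefined at
  -- `y`.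
  obtain ⟨a, h0, h1⟩ : ∃ a, homOf y a ≠ ⊥ ∧ homOf y a ≠ ⊤ := by
    by_contra hne
    push Not at hne
    have hy : y ∈ (D R A).op i y := by
      refine TopStr.mem_sub_op.2 (TopStr.mem_pow_op.2 fun a => ?_)
      change y.1 a ∈ (R i).toPFun (y.1 a)
      rw [← homOf_apply]
      by_cases h : homOf y a = ⊥
      · rw [h]; exact (R i).bot_mem
      · rw [hne a h]; exact (R i).top_mem
    exact hi ((Θ.map_op_iff i _ _).1 hy).1
  obtain ⟨F, hF⟩ := exists_injective_of_ne h0 h1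
  let G : {v : C n // v ≠ ⊥} → X := fun v => Θ.toHomeomorph.symm (ofHom R (F v))
  have hG : Function.Injective G := fun v w h => hF <| DFunLike.coe_injective <|
    congrArg Subtype.val (Θ.toHomeomorph.symm.injective h)
  have h := Nat.card_le_card_of_injective G hG
  rw [Nat.card_eq_fintype_card, Fintype.card_subtype_compl, Fintype.card_fin,
    Fintype.card_subtype_eq, Nat.card_coe_set_eq] at h
  omega

theorem mem_fMap (i : Set.Icc 1 (n - 3)) (x y : C n) :
    y ∈ (fMap n i).toPFun x ↔
      x.val ≠ i.1 + 1 ∧ y.val = if x.val = i.1 then i.1 + 1 else x.val := by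
  rw [mem_fMap_iff, mem_gMap]
  split_ifs <;> omega

variable {σ : Idx n → PartialEnd (C n)}

/-- Only `g_j` could carry a value above `j` down to `j`, and it has been replaced by `f_j`, which
is undefined at `j + 1`. The set has `n - 1 - j < n - 1` elements. -/
theorem isClosedNonDual_of_fMap (hn : 4 ≤ n) (hσ : σ ∈ SigmaTuples n) (j : Set.Icc 1 (n - 3))
    (hj : σ (Sum.inl j) = fMap n j)
    (hg : ∀ i : Set.Icc 1 (n - 3), j < i → σ (Sum.inl i) = gMap n i) :
    IsClosedNonDual.{u} σ {x : C n | j.val < x.val} := by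
  have hj1 := j.2.1
  have hj2 := j.2.2
  refine isClosedNonDual_of_card (i := Sum.inl j) (x := ⟨j.1 + 1, by omega⟩) ?_ ?_
    (Nat.lt_succ_self _) ?_
  · rintro (i | ⟨⟩) x hx x' hx'
    · change j.1 < x.val at hx
      change j.1 < x'.val
      rcases lt_or_ge j i with hji | hij
      · rw [hg i hji, mem_gMap] at hx'
        have : j.1 < i.1 := hji
        split_ifs at hx' <;> omega
      · have : i.1 ≤ j.1 := hij
        rcases hσ.1 i with h | h
        · rw [h, mem_fMap] at hx'
          split_ifs at hx' <;> omega
        · rcases this.lt_or_eq with hlt | heq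
          · rw [h, mem_gMap] at hx'
            split_ifs at hx' <;> omega
          · rw [Subtype.ext heq, hj, mem_fMap] at hx'
            split_ifs at hx' <;> omega
    · obtain ⟨k, hk⟩ := hσ.2
      change j.1 < x.val at hx
      change j.1 < x'.val
      rw [hk, mem_hMap] at hx'
      split_ifs at hx' <;> omega
  · have : {x : C n | j.val < x.val} = ↑(Finset.Ioi (⟨j.1, by omega⟩ : Fin n)) := by
      ext x
      rw [Finset.coe_Ioi]
      rfl
    rw [this, Set.ncard_coe_finset, Fin.card_Ioi]
    dsimp only
    omega
  · rw [hj]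
    exact fun h => h rfl

/-- Since `k ≥ 2`, `h_k` fixes `1`; each `g_i` fixes `1` and `n - 1` where defined, and `g_1` is
undefined at `1`. Two elements are fewer than `n - 1` because `n ≥ 4`. -/
theorem isClosedNonDual_of_hMap (hn : 4 ≤ n)
    (hg : ∀ i : Set.Icc 1 (n - 3), σ (Sum.inl i) = gMap n i) (k : Set.Icc 1 (n - 2))
    (hk1 : k.val ≠ 1) (hk : σ (Sum.inr ()) = hMap n k) :
    IsClosedNonDual.{u} σ {x : C n | x.val = 1 ∨ x.val = n - 1} := by
  have hk' := k.2.1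
  refine isClosedNonDual_of_card (i := Sum.inl ⟨1, le_rfl, by omega⟩) (x := ⟨1, by omega⟩) ?_ ?_
    (.inl rfl) ?_
  · rintro (i | ⟨⟩) x hx x' hx'
    · have := i.2.1
      have := i.2.2
      change x.val = 1 ∨ x.val = n - 1 at hx
      change x'.val = 1 ∨ x'.val = n - 1
      rw [hg, mem_gMap] at hx'
      split_ifs at hx' <;> omega
    · change x.val = 1 ∨ x.val = n - 1 at hx
      change x'.val = 1 ∨ x'.val = n - 1
      rw [hk, mem_hMap] at hx'
      split_ifs at hx' <;> omega
  · have : {x : C n | x.val = 1 ∨ x.val = n - 1} =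
        {(⟨1, by omega⟩ : C n), (⟨n - 1, by omega⟩ : C n)} := by
      ext x
      simp only [Set.mem_insert_iff, Set.mem_singleton_iff, Fin.ext_iff]
      rfl
    rw [this]
    exact (Set.ncard_insert_le _ _).trans_lt (by rw [Set.ncard_singleton]; omega)
  · rw [hg]
    exact fun h => h rfl

end Chain

end GodelDuality

open GodelDuality in
theorem theorem5p1 (n : ℕ) [NeZero n] (hn : 4 ≤ n) (σ : Idx n → PartialEnd (C n))
    (hσ : σ ∈ SigmaTuples n) :
    (FullyDualises.{u} σ ↔ σ = gh₁ n hn) ∧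
    (∀ j : Set.Icc 1 (n - 3), σ (Sum.inl j) = fMap n j →
      (∀ i : Set.Icc 1 (n - 3), j < i → σ (Sum.inl i) = gMap n i) →
        IsClosedNonDual.{u} σ {x : C n | j.val < x.val}) ∧
    ((∀ i : Set.Icc 1 (n - 3), σ (Sum.inl i) = gMap n i) →
      ∀ k : Set.Icc 1 (n - 2), k.val ≠ 1 → σ (Sum.inr ()) = hMap n k →
        IsClosedNonDual.{u} σ {x : C n | x.val = 1 ∨ x.val = n - 1}) := by
  refine ⟨⟨fun h => ?_, ?_⟩, fun j hj hg => isClosedNonDual_of_fMap hn hσ j hj hg,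
    fun hg k hk1 hk => isClosedNonDual_of_hMap hn hg k hk1 hk⟩
  · by_cases hg : ∀ i : Set.Icc 1 (n - 3), σ (Sum.inl i) = gMap n i
    · obtain ⟨k, hk⟩ := hσ.2
      by_cases hk1 : k.val = 1
      · refine funext fun i => ?_
        rcases i with i | ⟨⟩
        · exact hg i
        · rw [hk, show k = ⟨1, le_rfl, by omega⟩ from Subtype.ext hk1]
          rfl
      · exact absurd h (isClosedNonDual_of_hMap hn hg k hk1 hk).not_fullyDualises
    · push Not at hg
      -- The largest index not carrying `g_i` must carry `f_i`, and all later ones carry `g_i`.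
      obtain ⟨j, hj⟩ := exists_maximal_of_wellFoundedGT
        (fun i : Set.Icc 1 (n - 3) => σ (Sum.inl i) ≠ gMap n i) hg
      refine absurd h (isClosedNonDual_of_fMap hn hσ j ((hσ.1 j).resolve_right hj.prop)
        fun i hji => ?_).not_fullyDualises
      by_contra hi
      exact hji.not_ge (hj.le_of_ge hi hji.le)
  · rintro rfl
    exact fullyDualises_gh₁ hn
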